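/- Model. Fix $K\ge 1$. A bandit instance is a vector of means $\mu\in\mathbb R^K$ having a unique optimal arm, which is labelled $1$ in the formulas below (any of the $K$ arms may be the optimal one; the agent does not know which, i.e. relabelling the arms gives again an instance). Put $\Delta_i=\mu_1-\mu_i$ and write $a\vee b=\max\{a,b\}$. In round $t=1,2,\dots$ the agent pulls an arm $A_t$ and observes $X_t$, which given $A_t$ is $\mathcal N(\mu_{A_t},1)$-distributed and independent of the past. In the canonical model a (possibly randomized) policy chooses $A_t$ depending on $(A_1,X_1,\dots,A_{t-1},X_{t-1})$, and its regret is $R^{\mathrm{CA}}_\mu(T)=T\mu_1-\mathbb E[\sum_{t=1}^T X_t]$. In the fixed-reward abstention model with abstention reward $c\in\mathbb R$ the agent chooses, before observing $X_t$, also $B_t\in\{0,1\}$ ($B_t=1$ means abstaining), observes $X_t$ in either case, and has regret $$R^{\mathrm{RW}}_{\mu,c}(T)=T(\mu_1\vee c)-\mathbb E\Big[\sum_{t=1}^T\big(X_t\mathbf 1\{B_t=0\}+c\,\mathbf 1\{B_t=1\}\big)\Big].$$ Base algorithm. A canonical algorithm ALG (which may, but need not, know the horizon $T$) is asymptotically optimal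 if for every instance $\mu$, $\lim_{T\to\infty}R^{\mathrm{CA}}_\mu(T)/\log T=\sum_{i>1}2/\Delta_i$. It is minimax optimal with constant $\alpha_1>0$ if $R^{\mathrm{CA}}_\mu(T)\le\alpha_1\big(\sqrt{KT}+\sum_{i>1}\Delta_i\big)$ for all instances $\mu$ and all $T$, and minimax optimal if this holds for some $\alpha_1>0$. Wrapper. Given ALG and $c$, in round $t$ pull the arm $A_t$ chosen by ALG from $(A_1,X_1,\dots,A_{t-1},X_{t-1})$, and abstain ($B_t=1$) if and only if $\hat\mu_{A_t}(t-1)\le c$, where $\hat\mu_i(t-1)$ is the empirical mean of all observations from arm $i$ in rounds $1,\dots,t-1$, and $+\infty$ if there are none. Theorem. (1) If ALG is both asymptotically and minimax optimal, then for all $c\in\mathbb R$ and all instances $\mu$ the wrapped algorithm satisfies $$\limsup_{T\to\infty}\frac{R^{\mathrm{RW}}_{\mu,c}(T)}{\log T}\le 2\sum_{i>1}\frac{\mu_1\vee c-\mu_i\vee c}{\Delta_i^2}.$$ (2) For every $\alpha_1>0$ there is a constant $\alpha>0$, depending only on $\alpha_1$, such that for every $K\ge 1$, every asymptotically optimal ALG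 for $K$ arms which is minimax optimal with constant $\alpha_1$, all $c\in\mathbb R$, all instances $\mu$ with $K$ arms and all $T$, the wrapped algorithm satisfies $$R^{\mathrm{RW}}_{\mu,c}(T)\le\alpha\Big(\sqrt{KT}+\sum_{i=1}^K(\mu_1\vee c-\mu_i)\Big).$$ -/

import Mathlib

open MeasureTheory ProbabilityTheory Filter

noncomputable section

namespace AbstainingBandit

/-! ### Sequential interaction -/

/-- What is known after `t` rounds: the action chosen and the real observation received in each of
the rounds `0, …, t - 1`. -/
abbrev History (α : Type*) (t : ℕ) : Type _ := Fin t → α × ℝ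

/-- A (possibly randomized) online policy with action set `α`: given the history of the first `t`
rounds, `select t` is the law of the action of the next round. Deterministic policies are the
special case of Dirac kernels. -/
structure Policy (α : Type*) [MeasurableSpace α] where
  select : (t : ℕ) → Kernel (History α t) α
  markov : ∀ t, IsMarkovKernel (select t)

attribute [instance] Policy.markov

section Interaction

variable {α : Type*} [MeasurableSpace α]

/-- Append one round to a history. -/
def History.append {t : ℕ} (p : History α t × (α × ℝ)) : History α (t + 1) :=
  Fin.snoc (α := fun _ => α × ℝ) p.1 p.2

theorem History.measurable_append {t : ℕ} :
    Measurable (History.append : History α t × (α × ℝ) → History α (t + 1)) := by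
  refine measurable_pi_iff.2 fun j => ?_
  refine Fin.lastCases ?_ (fun i => ?_) j
  · simpa [History.append] using measurable_snd
  · simp only [History.append, Fin.snoc_castSucc]
    exact (measurable_pi_apply i).comp measurable_fst

/-- The law of one round, given the history: an action drawn by the policy, then an observation
drawn from `obs` at that action, independent of the past given the action. -/
def Policy.round (π : Policy α) (obs : Kernel α ℝ) (t : ℕ) : Kernel (History α t) (α × ℝ) :=
  (π.select t) ⊗ₖ (Kernel.prodMkLeft (History α t) obs)

/-- The law of the history of the first `T` rounds when the policy `π` interacts with an
environment whose observations have law `obs a` after action `a`. -/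
def Policy.law (π : Policy α) (obs : Kernel α ℝ) : (T : ℕ) → Measure (History α T)
  | 0 => Measure.dirac Fin.elim0
  | T + 1 => ((π.law obs T) ⊗ₘ (π.round obs T)).map History.append

instance Policy.isMarkovKernel_round (π : Policy α) (obs : Kernel α ℝ) [IsMarkovKernel obs]
    (t : ℕ) : IsMarkovKernel (π.round obs t) := by
  unfold Policy.round; infer_instance

instance Policy.isProbabilityMeasure_law (π : Policy α) (obs : Kernel α ℝ) [IsMarkovKernel obs]
    (T : ℕ) : IsProbabilityMeasure (π.law obs T) := by
  induction T with
  | zero => unfold Policy.law; infer_instance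
  | succ T ih =>
    unfold Policy.law
    exact Measure.isProbabilityMeasure_map History.measurable_append.aemeasurable

end Interaction

/-! ### Bandit instances -/

/-- A Gaussian bandit instance with `K` arms: a vector of means having a unique optimal arm
`best` (which may be any of the arms, and is not known to the agent). -/
structure Instance (K : ℕ) where
  mean : Fin K → ℝ
  best : Fin K
  best_unique : ∀ i, i ≠ best → mean i < mean best

/-- The suboptimality gap of an arm. -/
def Instance.gap {K : ℕ} (ν : Instance K) (i : Fin K) : ℝ := ν.mean ν.best - ν.mean i

/-- Pulling arm `i` yields an observation with law `𝒩 (mean i, 1)`. -/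
def Instance.armLaw {K : ℕ} (ν : Instance K) : Kernel (Fin K) ℝ :=
  Kernel.ofFunOfCountable fun i => gaussianReal (ν.mean i) 1

instance Instance.isMarkovKernel_armLaw {K : ℕ} (ν : Instance K) : IsMarkovKernel ν.armLaw :=
  ⟨fun i => by
    change IsProbabilityMeasure (gaussianReal (ν.mean i) 1)
    infer_instance⟩

/-- With the option to abstain, an action is a pair `(A, B)` of an arm `A` and an abstention
indicator `B` (`true` means abstain). The law of the observation depends on the arm only. -/
def Instance.armAbstainLaw {K : ℕ} (ν : Instance K) : Kernel (Fin K × Bool) ℝ :=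
  Kernel.prodMkRight Bool ν.armLaw

/-! ### The canonical model (no abstention) -/

/-- The expected canonical regret `T μ⋆ - 𝔼[∑ X_t]` over horizon `T`. -/
def canonicalRegret {K : ℕ} (ν : Instance K) (T : ℕ) (π : Policy (Fin K)) : ℝ :=
  T * ν.mean ν.best - ∫ h, ∑ t, (h t).2 ∂(π.law ν.armLaw T)

/-- An algorithm for `K` arms. It may use the horizon: `ALG T` is the policy that is run when the
horizon is `T`. An anytime algorithm is a constant function. -/
abbrev Algorithm (K : ℕ) : Type := ℕ → Policy (Fin K)

/-- Asymptotic optimality in the canonical model. -/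
def IsAsymptoticallyOptimal {K : ℕ} (ALG : Algorithm K) : Prop :=
  ∀ ν : Instance K,
    Tendsto (fun T : ℕ => canonicalRegret ν T (ALG T) / Real.log T) atTop
      (nhds (∑ i ∈ Finset.univ.erase ν.best, 2 / ν.gap i))

/-- Minimax optimality in the canonical model, with the constant `α₁`. -/
def IsMinimaxOptimalWith {K : ℕ} (α₁ : ℝ) (ALG : Algorithm K) : Prop :=
  ∀ (ν : Instance K) (T : ℕ),
    canonicalRegret ν T (ALG T) ≤
      α₁ * (√((K : ℝ) * T) + ∑ i ∈ Finset.univ.erase ν.best, ν.gap i)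

/-- Minimax optimality in the canonical model. -/
def IsMinimaxOptimal {K : ℕ} (ALG : Algorithm K) : Prop :=
  ∃ α₁ : ℝ, 0 < α₁ ∧ IsMinimaxOptimalWith α₁ ALG

/-! ### The fixed-reward abstention model -/

/-- The expected regret in the fixed-reward setting with abstention reward `c`:
`T (μ⋆ ∨ c) - 𝔼[∑ (X_t 1{B_t = 0} + c 1{B_t = 1})]`. -/
def fixedRewardRegret {K : ℕ} (ν : Instance K) (c : ℝ) (T : ℕ) (π : Policy (Fin K × Bool)) : ℝ :=
  T * max (ν.mean ν.best) c
    - ∫ h, ∑ t, (if (h t).1.2 = true then c else (h t).2) ∂(π.law ν.armAbstainLaw T)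

/-- The partial history that forgets the abstention decisions. -/
def forgetAbstention {K t : ℕ} (h : History (Fin K × Bool) t) : History (Fin K) t :=
  fun s => ((h s).1.1, (h s).2)

theorem measurable_forgetAbstention {K t : ℕ} :
    Measurable (forgetAbstention : History (Fin K × Bool) t → History (Fin K) t) := by
  unfold forgetAbstention
  fun_prop

/-- The number of pulls of arm `i` in a history. -/
def pullCount {K t : ℕ} (h : History (Fin K) t) (i : Fin K) : ℕ :=
  (Finset.univ.filter fun s => (h s).1 = i).card

/-- The empirical mean of arm `i`, equal to `+∞` when the arm has not been pulled. -/
def empiricalMean {K t : ℕ} (h : History (Fin K) t) (i : Fin K) : EReal :=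
  if pullCount h i = 0 then ⊤
  else (((∑ s, if (h s).1 = i then (h s).2 else 0) / (pullCount h i : ℝ) : ℝ) : EReal)

open Classical in
/-- The abstention rule: given the history and the arm pulled in the present round, abstain if and
only if the empirical mean of this arm is at most `c`. -/
def abstainRule {K : ℕ} (c : ℝ) (t : ℕ) (p : History (Fin K × Bool) t × Fin K) : Bool :=
  decide (empiricalMean (forgetAbstention p.1) p.2 ≤ (c : EReal))

theorem measurable_pullCount {K t : ℕ} (i : Fin K) :
    Measurable fun h : History (Fin K) t => pullCount h i := by
  unfold pullCount
  simp_rw [Finset.card_filter]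
  refine Finset.measurable_sum _ fun s _ => ?_
  exact Measurable.ite (measurableSet_eq_fun (by fun_prop) measurable_const)
    measurable_const measurable_const

theorem measurable_empiricalMean {K t : ℕ} (i : Fin K) :
    Measurable fun h : History (Fin K) t => empiricalMean h i := by
  have hN := measurable_pullCount (t := t) i
  refine Measurable.ite (hN (measurableSet_singleton 0)) measurable_const ?_
  refine Measurable.coe_real_ereal (Measurable.div ?_ ?_)
  · refine Finset.measurable_sum _ fun s _ => ?_
    exact Measurable.ite (measurableSet_eq_fun (by fun_prop) measurable_const)
      (by fun_prop) measurable_const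
  · exact measurable_from_top.comp hN

theorem measurable_abstainRule {K : ℕ} (c : ℝ) (t : ℕ) :
    Measurable (abstainRule (K := K) c t) := by
  refine measurable_from_prod_countable_left fun i => ?_
  refine measurable_to_bool ?_
  have : (fun h : History (Fin K × Bool) t => abstainRule c t (h, i)) ⁻¹' {true} =
      {h | empiricalMean (forgetAbstention h) i ≤ (c : EReal)} := by
    ext h; simp [abstainRule]
  rw [this]
  exact measurableSet_le ((measurable_empiricalMean i).comp measurable_forgetAbstention)
    measurable_const

/-- The wrapper with abstention reward `c`: in each round the arm is chosen by the base policy from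
the past arms and observations, and the agent abstains according to `abstainRule`. -/
def withAbstention {K : ℕ} (c : ℝ) (π : Policy (Fin K)) : Policy (Fin K × Bool) where
  select t :=
    ((π.select t).comap forgetAbstention measurable_forgetAbstention) ⊗ₖ
      Kernel.deterministic (abstainRule c t) (measurable_abstainRule c t)
  markov t := by infer_instance

end AbstainingBandit

end

open MeasureTheory ProbabilityTheory Filter

noncomputable section

namespace AbstainingBandit

/-! Forgetting the abstention decisions turns the law of the wrapped algorithm into the law of ALG.
Hence the regret splits exactly (`fixedRewardRegret_eq`) into the sum of (μ₁ ∨ c - μᵢ ∨ c) 𝔼Nᵢ and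
the sum of |μᵢ - c| 𝔼Wᵢ. Here Nᵢ counts the pulls of arm i by ALG, and Wᵢ counts those pulls at
which the empirical mean lies on the wrong side of c.

Wrong decisions are rare whatever ALG does. An exponential supermartingale in the observations of
the arm gives 𝔼Wᵢ ≤ 2/(μᵢ - c)² + 1{μᵢ ≤ c}, uniformly in T (`expectedWrong_le`).

For the logarithmic bound the second sum is therefore O(1), and what is needed is 𝔼Nᵢ / log T →
2/Δᵢ² for each suboptimal arm separately. Asymptotic optimality only gives the limit of the
Δ-weighted sum. It also makes ALG consistent on every instance, so the Lai–Robbins change of measure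
bounds each term from below; a convergent sum whose terms have sharp lower bounds converges term by
term (`tendsto_of_tendsto_sum_of_eventually_lt`).

For the minimax bound the first sum is at most the canonical regret, and the second is split at |μᵢ
- c| = √(K/T): below it Wᵢ ≤ Nᵢ is used, above it the bound on 𝔼Wᵢ. -/

theorem sum_append {α : Type*} {t : ℕ} (g : α × ℝ → ℝ) (p : History α t × (α × ℝ)) :
    ∑ s, g (History.append p s) = ∑ s, g (p.1 s) + g p.2 := by
  simp [Fin.sum_univ_castSucc, History.append]

/-! ### Integrals along a sequential interaction -/

section Interaction

variable {α : Type*} [MeasurableSpace α]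

theorem Policy.lintegral_round (π : Policy α) (obs : Kernel α ℝ) [IsMarkovKernel obs] (t : ℕ)
    (h : History α t) {f : α × ℝ → ENNReal} (hf : Measurable f) :
    ∫⁻ z, f z ∂(π.round obs t h) = ∫⁻ a, ∫⁻ x, f (a, x) ∂(obs a) ∂(π.select t h) := by
  unfold Policy.round
  rw [Kernel.lintegral_compProd _ _ _ hf]
  simp [Kernel.prodMkLeft_apply]

theorem Policy.lintegral_law_zero (π : Policy α) (obs : Kernel α ℝ)
    {f : History α 0 → ENNReal} (hf : Measurable f) :
    ∫⁻ h, f h ∂(π.law obs 0) = f Fin.elim0 := by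
  unfold Policy.law
  exact lintegral_dirac' _ hf

theorem Policy.lintegral_law_succ (π : Policy α) (obs : Kernel α ℝ) [IsMarkovKernel obs] (T : ℕ)
    {f : History α (T + 1) → ENNReal} (hf : Measurable f) :
    ∫⁻ h, f h ∂(π.law obs (T + 1)) = ∫⁻ h, ∫⁻ a, ∫⁻ x, f (History.append (h, (a, x)))
      ∂(obs a) ∂(π.select T h) ∂(π.law obs T) := by
  have hf' : Measurable fun p => f (History.append (t := T) p) :=
    hf.comp History.measurable_append
  conv_lhs => unfold Policy.law
  rw [lintegral_map hf History.measurable_append, Measure.lintegral_compProd hf']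
  refine lintegral_congr fun h => ?_
  exact π.lintegral_round obs T h (hf'.comp measurable_prodMk_left)

/-- If a potential decreases in conditional mean by at least the running cost, then the expected
total cost is at most the initial potential. -/
theorem Policy.sum_lintegral_le_of_drift (π : Policy α) (obs : Kernel α ℝ) [IsMarkovKernel obs]
    (V : (t : ℕ) → History α t → ENNReal) (hV : ∀ t, Measurable (V t))
    (D : (t : ℕ) → History α t → α → ENNReal)
    (hD : ∀ t, Measurable fun p : History α t × α => D t p.1 p.2)
    (hdrift : ∀ t h a, D t h a + ∫⁻ x, V (t + 1) (History.append (h, (a, x))) ∂(obs a) ≤ V t h)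
    (T : ℕ) :
    ∑ t ∈ Finset.range T, ∫⁻ h, ∫⁻ a, D t h a ∂(π.select t h) ∂(π.law obs t)
      ≤ V 0 Fin.elim0 := by
  -- The induction has to carry the potential still left after T rounds.
  suffices H : ∑ t ∈ Finset.range T, ∫⁻ h, ∫⁻ a, D t h a ∂(π.select t h) ∂(π.law obs t)
      + ∫⁻ h, V T h ∂(π.law obs T) ≤ V 0 Fin.elim0 from le_self_add.trans H
  induction T with
  | zero => simp [π.lintegral_law_zero obs (hV 0)]
  | succ T ih =>
    refine le_trans ?_ ih
    rw [Finset.sum_range_succ, add_assoc, π.lintegral_law_succ obs T (hV _),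
      ← lintegral_add_left (hD T).lintegral_kernel_prod_right']
    gcongr with h
    have hm : Measurable fun a => D T h a := (hD T).comp measurable_prodMk_left
    dsimp only
    rw [← lintegral_add_left hm]
    calc _ ≤ ∫⁻ _, V T h ∂(π.select T h) := lintegral_mono fun a => hdrift T h a
      _ = V T h := by simp

variable (π : Policy α) (obs : Kernel α ℝ) [IsMarkovKernel obs] {g : α × ℝ → ℝ} {C : NNReal}

theorem Policy.integrable_round (hg : Measurable g)
    (hC : ∀ a, ∫⁻ x, ‖g (a, x)‖ₑ ∂(obs a) ≤ C) (t : ℕ) (h : History α t) :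
    Integrable g (π.round obs t h) := by
  refine ⟨hg.aestronglyMeasurable, ?_⟩
  rw [HasFiniteIntegral, π.lintegral_round obs t h hg.enorm]
  calc _ ≤ ∫⁻ _, (C : ENNReal) ∂(π.select t h) := lintegral_mono fun a => hC a
    _ < ⊤ := by simp

theorem Policy.integrable_compProd_round (hg : Measurable g)
    (hC : ∀ a, ∫⁻ x, ‖g (a, x)‖ₑ ∂(obs a) ≤ C) (t : ℕ) :
    Integrable (fun p : History α t × (α × ℝ) => g p.2) (π.law obs t ⊗ₘ π.round obs t) := by
  have hg2 : Measurable fun p : History α t × (α × ℝ) => g p.2 := hg.comp measurable_snd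
  refine ⟨hg2.aestronglyMeasurable, ?_⟩
  rw [HasFiniteIntegral, Measure.lintegral_compProd hg2.enorm]
  calc _ ≤ ∫⁻ _, (C : ENNReal) ∂(π.law obs t) := by
        refine lintegral_mono fun h => ?_
        rw [π.lintegral_round obs t h hg.enorm]
        calc _ ≤ ∫⁻ _, (C : ENNReal) ∂(π.select t h) := lintegral_mono fun a => hC a
          _ = C := by simp
    _ < ⊤ := by simp

theorem measurable_sum_history {t : ℕ} (hg : Measurable g) :
    Measurable fun h : History α t => ∑ s, g (h s) :=
  Finset.measurable_sum _ fun s _ => hg.comp (measurable_pi_apply s)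

theorem Policy.integrable_sum_history (hg : Measurable g)
    (hC : ∀ a, ∫⁻ x, ‖g (a, x)‖ₑ ∂(obs a) ≤ C) (T : ℕ) :
    Integrable (fun h : History α T => ∑ s, g (h s)) (π.law obs T) := by
  induction T with
  | zero => simp
  | succ T ih =>
    unfold Policy.law
    rw [integrable_map_measure (measurable_sum_history hg).aestronglyMeasurable
      History.measurable_append.aemeasurable]
    have h1 : Integrable (fun p : History α T × (α × ℝ) => ∑ s, g (p.1 s))
        (π.law obs T ⊗ₘ π.round obs T) := by
      rw [← Measure.fst_compProd (π.law obs T) (π.round obs T)] at ih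
      exact ih.comp_measurable measurable_fst
    exact (h1.add (π.integrable_compProd_round obs hg hC T)).congr
      (ae_of_all _ fun p => (sum_append g p).symm)

/-- The expectation of an additive functional of the history. -/
theorem Policy.integral_sum_history (hg : Measurable g)
    (hC : ∀ a, ∫⁻ x, ‖g (a, x)‖ₑ ∂(obs a) ≤ C) (T : ℕ) :
    ∫ h, ∑ s, g (h s) ∂(π.law obs T) = ∑ t ∈ Finset.range T,
      ∫ h, ∫ a, ∫ x, g (a, x) ∂(obs a) ∂(π.select t h) ∂(π.law obs t) := by
  induction T with
  | zero => simp
  | succ T ih =>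
    have h0 := π.integrable_sum_history obs hg hC T
    have h1 : Integrable (fun p : History α T × (α × ℝ) => ∑ s, g (p.1 s))
        (π.law obs T ⊗ₘ π.round obs T) := by
      rw [← Measure.fst_compProd (π.law obs T) (π.round obs T)] at h0
      exact h0.comp_measurable measurable_fst
    conv_lhs => unfold Policy.law
    rw [integral_map History.measurable_append.aemeasurable
      (measurable_sum_history hg).aestronglyMeasurable]
    simp_rw [sum_append]
    rw [integral_add h1 (π.integrable_compProd_round obs hg hC T), Measure.integral_compProd h1,
      Measure.integral_compProd (π.integrable_compProd_round obs hg hC T), Finset.sum_range_succ]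
    simp only [integral_const, probReal_univ, one_smul]
    rw [ih]
    congr 1
    refine integral_congr_ae (ae_of_all _ fun h => ?_)
    have := π.integrable_round obs hg hC T h
    unfold Policy.round at this ⊢
    simp only
    rw [integral_compProd this]
    simp [Kernel.prodMkLeft_apply]

end Interaction

/-- With finitely many actions, integrability for each action is automatically uniform; this
supplies the constant that the lemmas on additive functionals ask for. -/
theorem exists_lintegral_enorm_le {α : Type*} [Finite α] [MeasurableSpace α] (obs : Kernel α ℝ)
    {g : α × ℝ → ℝ} (hg : ∀ a, Integrable (fun x => g (a, x)) (obs a)) :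
    ∃ C : NNReal, ∀ a, ∫⁻ x, ‖g (a, x)‖ₑ ∂(obs a) ≤ C := by
  have := Fintype.ofFinite α
  refine ⟨∑ a, (∫⁻ x, ‖g (a, x)‖ₑ ∂(obs a)).toNNReal, fun a => ?_⟩
  rw [← ENNReal.coe_toNNReal (hg a).2.ne]
  exact_mod_cast Finset.single_le_sum
    (f := fun a => (∫⁻ x, ‖g (a, x)‖ₑ ∂(obs a)).toNNReal) (fun _ _ => zero_le)
    (Finset.mem_univ a)

/-! ### Regret decompositions -/

section Regret

variable {K : ℕ} (ν : Instance K) (π : Policy (Fin K))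

theorem Instance.armLaw_apply (i : Fin K) : ν.armLaw i = gaussianReal (ν.mean i) 1 := rfl

theorem Instance.armAbstainLaw_apply (p : Fin K × Bool) :
    ν.armAbstainLaw p = gaussianReal (ν.mean p.1) 1 := rfl

instance Instance.isMarkovKernel_armAbstainLaw : IsMarkovKernel ν.armAbstainLaw := by
  unfold Instance.armAbstainLaw; infer_instance

theorem integrable_id_gaussianReal_one (m : ℝ) : Integrable (fun x => x) (gaussianReal m 1) :=
  (memLp_id_gaussianReal (μ := m) (v := 1) 1).integrable le_rfl

/-- The probability that arm `i` is pulled in the round that follows the history `h`. -/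
def Policy.pullProb (t : ℕ) (h : History (Fin K) t) (i : Fin K) : ℝ := (π.select t h).real {i}

theorem Policy.measurable_pullProb (t : ℕ) (i : Fin K) :
    Measurable fun h : History (Fin K) t => π.pullProb t h i :=
  (Kernel.measurable_coe (π.select t) (measurableSet_singleton i)).ennreal_toReal

theorem Policy.pullProb_nonneg (t : ℕ) (h : History (Fin K) t) (i : Fin K) :
    0 ≤ π.pullProb t h i := measureReal_nonneg

theorem Policy.pullProb_le_one (t : ℕ) (h : History (Fin K) t) (i : Fin K) :
    π.pullProb t h i ≤ 1 := measureReal_le_one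

theorem Policy.integral_select (t : ℕ) (h : History (Fin K) t) (r : Fin K → ℝ) :
    ∫ a, r a ∂(π.select t h) = ∑ i, π.pullProb t h i * r i := by
  rw [integral_fintype .of_finite]
  rfl

theorem Policy.sum_pullProb (t : ℕ) (h : History (Fin K) t) : ∑ i, π.pullProb t h i = 1 := by
  simpa using (π.integral_select t h fun _ => 1).symm

theorem Policy.integrable_pullProb (t : ℕ) (i : Fin K) :
    Integrable (fun h => π.pullProb t h i) (π.law ν.armLaw t) :=
  Integrable.of_bound (π.measurable_pullProb t i).aestronglyMeasurable 1 <|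
    ae_of_all _ fun h => by
      rw [Real.norm_of_nonneg (π.pullProb_nonneg t h i)]
      exact π.pullProb_le_one t h i

/-- The expected number of pulls of arm `i` in the first `T` rounds. -/
def expectedPulls (T : ℕ) (i : Fin K) : ℝ :=
  ∑ t ∈ Finset.range T, ∫ h, π.pullProb t h i ∂(π.law ν.armLaw t)

theorem expectedPulls_nonneg (T : ℕ) (i : Fin K) : 0 ≤ expectedPulls ν π T i :=
  Finset.sum_nonneg fun t _ => integral_nonneg fun h => π.pullProb_nonneg t h i

theorem sum_expectedPulls (T : ℕ) : ∑ i, expectedPulls ν π T i = T := by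
  unfold expectedPulls
  rw [Finset.sum_comm]
  have : ∀ t, ∑ i, ∫ h, π.pullProb t h i ∂(π.law ν.armLaw t) = 1 := fun t => by
    rw [← integral_finsetSum _ fun i _ => π.integrable_pullProb ν t i]
    simp [π.sum_pullProb]
  simp [this]

/-- A Wald identity: given the arm, the observation is independent of the past, so only the expected
pull counts of the policy matter. -/
theorem integral_sum_history_arms {g : Fin K × ℝ → ℝ} (hg : Measurable g)
    (hi : ∀ a, Integrable (fun x => g (a, x)) (ν.armLaw a)) (T : ℕ) :
    ∫ h, ∑ s, g (h s) ∂(π.law ν.armLaw T)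
      = ∑ i, expectedPulls ν π T i * ∫ x, g (i, x) ∂(ν.armLaw i) := by
  obtain ⟨C, hC⟩ := exists_lintegral_enorm_le ν.armLaw hi
  rw [π.integral_sum_history ν.armLaw hg hC]
  unfold expectedPulls
  simp_rw [Finset.sum_mul]
  rw [Finset.sum_comm]
  refine Finset.sum_congr rfl fun t _ => ?_
  simp_rw [π.integral_select t]
  rw [integral_finsetSum _ fun i _ => (π.integrable_pullProb ν t i).mul_const _]
  simp_rw [integral_mul_const]

theorem canonicalRegret_eq (T : ℕ) :
    canonicalRegret ν T π = ∑ i, ν.gap i * expectedPulls ν π T i := by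
  have h := integral_sum_history_arms ν π (g := Prod.snd) measurable_snd
    (fun a => integrable_id_gaussianReal_one _) T
  unfold canonicalRegret
  simp only [ν.armLaw_apply, integral_id_gaussianReal] at h
  rw [h, ← sum_expectedPulls ν π T, Finset.sum_mul, ← Finset.sum_sub_distrib]
  refine Finset.sum_congr rfl fun i _ => ?_
  unfold Instance.gap
  ring

theorem forgetAbstention_append {t : ℕ} (h : History (Fin K × Bool) t) (a : Fin K) (b : Bool)
    (x : ℝ) : forgetAbstention (History.append (h, ((a, b), x)))
      = History.append (forgetAbstention h, (a, x)) := by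
  funext s
  refine Fin.lastCases ?_ (fun s => ?_) s <;> simp [forgetAbstention, History.append]

/-- An abstention decision affects neither the law of the observation nor the later arm choices,
since the base policy is fed the forgotten history; it can be integrated out round by round. -/
theorem lintegral_forgetAbstention (c : ℝ) (T : ℕ) {f : History (Fin K) T → ENNReal}
    (hf : Measurable f) :
    ∫⁻ h, f (forgetAbstention h) ∂((withAbstention c π).law ν.armAbstainLaw T)
      = ∫⁻ h, f h ∂(π.law ν.armLaw T) := by
  induction T with
  | zero =>
    have hf' : Measurable fun h : History (Fin K × Bool) 0 => f (forgetAbstention h) :=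
      hf.comp measurable_forgetAbstention
    rw [Policy.lintegral_law_zero _ _ hf', Policy.lintegral_law_zero _ _ hf]
    congr 1
    exact Subsingleton.elim _ _
  | succ T ih =>
    have hfa : Measurable fun p : (History (Fin K) T × Fin K) × ℝ =>
        f (History.append (p.1.1, (p.1.2, p.2))) :=
      hf.comp (History.measurable_append.comp (by fun_prop))
    have hin : Measurable fun p : History (Fin K) T × Fin K =>
        ∫⁻ x, f (History.append (p.1, (p.2, x))) ∂(ν.armLaw p.2) := by
      have := hfa.lintegral_kernel_prod_right'
        (κ := Kernel.prodMkLeft (History (Fin K) T) ν.armLaw)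
      simpa [Kernel.prodMkLeft_apply] using this
    have hf' : Measurable fun h : History (Fin K × Bool) (T + 1) => f (forgetAbstention h) :=
      hf.comp measurable_forgetAbstention
    rw [Policy.lintegral_law_succ _ _ _ hf', Policy.lintegral_law_succ _ _ _ hf,
      ← ih hin.lintegral_kernel_prod_right']
    refine lintegral_congr fun h => ?_
    simp_rw [withAbstention]
    rw [Kernel.lintegral_compProd _ _ _ (measurable_of_countable _)]
    simp only [Kernel.comap_apply]
    refine lintegral_congr fun a => ?_
    rw [Kernel.lintegral_deterministic]
    simp_rw [forgetAbstention_append]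
    rfl

theorem map_forgetAbstention_law (c : ℝ) (T : ℕ) :
    ((withAbstention c π).law ν.armAbstainLaw T).map forgetAbstention = π.law ν.armLaw T := by
  refine Measure.ext_of_lintegral _ fun f hf => ?_
  rw [lintegral_map hf measurable_forgetAbstention, lintegral_forgetAbstention ν π c T hf]

/-- The abstention decision for arm `i` after the history `h` is not the one that would be taken
with knowledge of the mean of this arm. -/
def Instance.wrongDecision (c : ℝ) {t : ℕ} (i : Fin K) (h : History (Fin K) t) : Prop :=
  ¬(empiricalMean h i ≤ (c : EReal) ↔ ν.mean i ≤ c)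

theorem Instance.measurableSet_wrongDecision (c : ℝ) (t : ℕ) (i : Fin K) :
    MeasurableSet {h : History (Fin K) t | ν.wrongDecision c i h} := by
  have h1 : MeasurableSet {h : History (Fin K) t | empiricalMean h i ≤ (c : EReal)} :=
    measurableSet_le (measurable_empiricalMean i) measurable_const
  exact (h1.iff (MeasurableSet.const (ν.mean i ≤ c))).compl

/-- The expected number of rounds before `T` in which arm `i` is pulled with a wrong abstention
decision. -/
def expectedWrong (c : ℝ) (T : ℕ) (i : Fin K) : ℝ :=
  ∑ t ∈ Finset.range T, ∫ h, {h | ν.wrongDecision c i h}.indicator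
    (fun h => π.pullProb t h i) h ∂(π.law ν.armLaw t)

theorem Policy.integral_select_withAbstention (c : ℝ) (t : ℕ) (h : History (Fin K × Bool) t)
    (r : Fin K × Bool → ℝ) :
    ∫ a, r a ∂((withAbstention c π).select t h)
      = ∑ i, π.pullProb t (forgetAbstention h) i * r (i, abstainRule c t (h, i)) := by
  have hi : Integrable r ((withAbstention c π).select t h) := .of_finite
  simp_rw [withAbstention] at hi ⊢
  rw [integral_compProd hi]
  simp only [Kernel.comap_apply, Kernel.integral_deterministic]
  exact π.integral_select t (forgetAbstention h) fun i => r (i, abstainRule c t (h, i))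

-- Given arm i, the correct decision earns max(μᵢ, c) in mean and the wrong one earns |μᵢ - c| less.
-- The pulls sum to T, which distributes the benchmark over the arms.
open Classical in
theorem fixedRewardRegret_eq (c : ℝ) (T : ℕ) :
    fixedRewardRegret ν c T (withAbstention c π)
      = ∑ i, (max (ν.mean ν.best) c - max (ν.mean i) c) * expectedPulls ν π T i
        + ∑ i, |ν.mean i - c| * expectedWrong ν π c T i := by
  set g : (Fin K × Bool) × ℝ → ℝ := fun p => if p.1.2 = true then c else p.2 with hgdef
  have hg : Measurable g :=
    Measurable.ite (measurableSet_eq_fun (by fun_prop) measurable_const) measurable_const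
      measurable_snd
  have hi : ∀ a, Integrable (fun x => g (a, x)) (ν.armAbstainLaw a) := by
    rintro ⟨a, b⟩
    cases b
    · simpa [hgdef, ν.armAbstainLaw_apply] using integrable_id_gaussianReal_one (ν.mean a)
    · simp [hgdef]
  obtain ⟨C, hC⟩ := exists_lintegral_enorm_le ν.armAbstainLaw hi
  have hr : ∀ a : Fin K × Bool, ∫ x, g (a, x) ∂(ν.armAbstainLaw a)
      = if a.2 = true then c else ν.mean a.1 := by
    rintro ⟨a, b⟩
    cases b <;> simp [hgdef, ν.armAbstainLaw_apply]
  have key : ∀ t, ∫ h, ∫ a, ∫ x, g (a, x) ∂(ν.armAbstainLaw a)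
        ∂((withAbstention c π).select t h) ∂((withAbstention c π).law ν.armAbstainLaw t)
      = ∑ i, (max (ν.mean i) c * ∫ h, π.pullProb t h i ∂(π.law ν.armLaw t)
        - |ν.mean i - c| * ∫ h, {h | ν.wrongDecision c i h}.indicator
          (fun h => π.pullProb t h i) h ∂(π.law ν.armLaw t)) := by
    intro t
    have hint : ∀ i, Integrable ({h | ν.wrongDecision c i h}.indicator
          (fun h => π.pullProb t h i)) (π.law ν.armLaw t) := fun i =>
      (π.integrable_pullProb ν t i).indicator (ν.measurableSet_wrongDecision c t i)
    have hint2 : ∀ i, Integrable (fun h => max (ν.mean i) c * π.pullProb t h i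
        - |ν.mean i - c| * {h | ν.wrongDecision c i h}.indicator
          (fun h => π.pullProb t h i) h) (π.law ν.armLaw t) := fun i =>
      ((π.integrable_pullProb ν t i).const_mul _).sub ((hint i).const_mul _)
    have hpt : ∀ h : History (Fin K × Bool) t,
        ∫ a, ∫ x, g (a, x) ∂(ν.armAbstainLaw a) ∂((withAbstention c π).select t h)
        = ∑ i, (max (ν.mean i) c * π.pullProb t (forgetAbstention h) i
          - |ν.mean i - c| * {h | ν.wrongDecision c i h}.indicator
            (fun h => π.pullProb t h i) (forgetAbstention h)) := by
      intro h
      simp_rw [hr]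
      rw [π.integral_select_withAbstention]
      refine Finset.sum_congr rfl fun i _ => ?_
      by_cases he : empiricalMean (forgetAbstention h) i ≤ (c : EReal) <;>
      by_cases hm : ν.mean i ≤ c
      · simp [abstainRule, he, hm, Set.indicator, Instance.wrongDecision, not_lt.2 he]; ring
      · have hm' := lt_of_not_ge hm
        simp [abstainRule, he, Set.indicator, Instance.wrongDecision, max_eq_left hm'.le,
          abs_of_pos (sub_pos.2 hm'), hm']; ring
      · simp [abstainRule, he, hm, Set.indicator, Instance.wrongDecision, lt_of_not_ge he,
          abs_of_nonpos (sub_nonpos.2 hm)]; ring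
      · have hm' := lt_of_not_ge hm
        simp [abstainRule, he, Set.indicator, Instance.wrongDecision, max_eq_left hm'.le,
          hm]; ring
    simp_rw [hpt]
    have hmeas : Measurable fun h => ∑ i, (max (ν.mean i) c * π.pullProb t h i
        - |ν.mean i - c| * {h | ν.wrongDecision c i h}.indicator
          (fun h => π.pullProb t h i) h) :=
      Finset.measurable_sum _ fun i _ => ((π.measurable_pullProb t i).const_mul _).sub
        (((π.measurable_pullProb t i).indicator
          (ν.measurableSet_wrongDecision c t i)).const_mul _)
    have := integral_map (μ := (withAbstention c π).law ν.armAbstainLaw t)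
      measurable_forgetAbstention.aemeasurable hmeas.aestronglyMeasurable
    rw [← this, map_forgetAbstention_law, integral_finsetSum _ fun i _ => hint2 i]
    refine Finset.sum_congr rfl fun i _ => ?_
    rw [integral_sub ((π.integrable_pullProb ν t i).const_mul _) ((hint i).const_mul _),
      integral_const_mul, integral_const_mul]
  unfold fixedRewardRegret
  have h1 := (withAbstention c π).integral_sum_history ν.armAbstainLaw hg hC T
  simp only [hgdef] at h1 key
  rw [h1, Finset.sum_congr rfl fun t _ => key t, Finset.sum_comm, ← sum_expectedPulls ν π T,
    Finset.sum_mul, ← Finset.sum_sub_distrib, ← Finset.sum_add_distrib]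
  refine Finset.sum_congr rfl fun i _ => ?_
  rw [Finset.sum_sub_distrib, ← Finset.mul_sum, ← Finset.mul_sum]
  unfold expectedPulls expectedWrong
  ring

theorem expectedWrong_nonneg (c : ℝ) (T : ℕ) (i : Fin K) : 0 ≤ expectedWrong ν π c T i :=
  Finset.sum_nonneg fun t _ => integral_nonneg fun h =>
    Set.indicator_nonneg (fun h _ => π.pullProb_nonneg t h i) h

theorem expectedWrong_le_expectedPulls (c : ℝ) (T : ℕ) (i : Fin K) :
    expectedWrong ν π c T i ≤ expectedPulls ν π T i :=
  Finset.sum_le_sum fun t _ => integral_mono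
    ((π.integrable_pullProb ν t i).indicator (ν.measurableSet_wrongDecision c t i))
    (π.integrable_pullProb ν t i)
    fun h => Set.indicator_le_self' (fun h _ => π.pullProb_nonneg t h i) h

end Regret

/-! ### Wrong abstention decisions -/

theorem lintegral_exp_mul_gaussianReal (m t : ℝ) :
    ∫⁻ x, ENNReal.ofReal (Real.exp (t * x)) ∂(gaussianReal m 1)
      = ENNReal.ofReal (Real.exp (m * t + t ^ 2 / 2)) := by
  rw [← ofReal_integral_eq_lintegral_ofReal (integrable_exp_mul_gaussianReal t)
    (ae_of_all _ fun x => (Real.exp_pos _).le)]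
  have := mgf_gaussianReal (p := gaussianReal m 1) (X := id) (μ := m) (v := 1)
    Measure.map_id t
  simp only [mgf, id, NNReal.coe_one, one_mul] at this
  rw [this]

section WrongDecisions

variable {K : ℕ}

theorem pullCount_eq_sum {t : ℕ} (h : History (Fin K) t) (i : Fin K) :
    pullCount h i = ∑ s, if (h s).1 = i then 1 else 0 := by
  unfold pullCount
  rw [Finset.card_filter]

theorem pullCount_append {t : ℕ} (h : History (Fin K) t) (z : Fin K × ℝ) (i : Fin K) :
    pullCount (History.append (h, z)) i = pullCount h i + if z.1 = i then 1 else 0 := by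
  simp only [pullCount_eq_sum, Fin.sum_univ_castSucc, History.append, Fin.snoc_castSucc,
    Fin.snoc_last]

/-- The sum of the observations from arm `i`, each reduced by `c`. -/
def centeredSum (c : ℝ) (i : Fin K) {t : ℕ} (h : History (Fin K) t) : ℝ :=
  ∑ s, if (h s).1 = i then (h s).2 - c else 0

theorem centeredSum_append (c : ℝ) (i : Fin K) {t : ℕ} (h : History (Fin K) t) (z : Fin K × ℝ) :
    centeredSum c i (History.append (h, z))
      = centeredSum c i h + if z.1 = i then z.2 - c else 0 := by
  simp [centeredSum, Fin.sum_univ_castSucc, History.append]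

theorem measurable_centeredSum (c : ℝ) (i : Fin K) (t : ℕ) :
    Measurable fun h : History (Fin K) t => centeredSum c i h :=
  Finset.measurable_sum _ fun s _ =>
    Measurable.ite (measurableSet_eq_fun (by fun_prop) measurable_const) (by fun_prop)
      measurable_const

theorem empiricalMean_le_iff (c : ℝ) {i : Fin K} {t : ℕ} {h : History (Fin K) t}
    (hN : pullCount h i ≠ 0) : empiricalMean h i ≤ (c : EReal) ↔ centeredSum c i h ≤ 0 := by
  have hpos : (0 : ℝ) < pullCount h i := by exact_mod_cast Nat.pos_of_ne_zero hN
  have : centeredSum c i h = (∑ s, if (h s).1 = i then (h s).2 else 0) - pullCount h i * c := by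
    rw [pullCount_eq_sum, centeredSum]
    push_cast
    rw [Finset.sum_mul, ← Finset.sum_sub_distrib]
    refine Finset.sum_congr rfl fun s _ => ?_
    split_ifs <;> ring
  rw [empiricalMean, if_neg hN, EReal.coe_le_coe_iff, div_le_iff₀ hpos, this, sub_nonpos, mul_comm]

variable (ν : Instance K) (π : Policy (Fin K))

/-- An arm without data has empirical mean `⊤`, so the agent does not abstain. This is the source of
the extra 1 in the bound on wrong decisions. -/
theorem Instance.wrongDecision_of_pullCount_eq_zero {c : ℝ} {i : Fin K} {t : ℕ}
    {h : History (Fin K) t} (hN : pullCount h i = 0) (hw : ν.wrongDecision c i h) :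
    ν.mean i ≤ c := by
  by_contra hm
  refine hw ⟨fun he => ?_, fun hm' => (hm hm').elim⟩
  simp [empiricalMean, hN] at he

/-- The Chernoff step: at a wrong decision the centered sum does not have the strict sign of μᵢ - c,
so the exponent is nonnegative and the exponential dominates the indicator. -/
theorem Instance.one_le_exp_of_wrongDecision {c : ℝ} {i : Fin K} {t : ℕ}
    {h : History (Fin K) t} (hN : pullCount h i ≠ 0) (hw : ν.wrongDecision c i h) :
    1 ≤ Real.exp (-(ν.mean i - c) * centeredSum c i h) := by
  rw [Real.one_le_exp_iff]
  unfold Instance.wrongDecision at hw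
  rw [empiricalMean_le_iff c hN] at hw
  by_cases hS : centeredSum c i h ≤ 0
  · have hm : ¬ν.mean i ≤ c := fun hm => hw (iff_of_true hS hm)
    nlinarith [lt_of_not_ge hm]
  · have hm : ν.mean i ≤ c := by
      by_contra hm
      exact hw (iff_of_false hS hm)
    nlinarith [lt_of_not_ge hS]

open Classical in
/-- Wrong abstention decisions for an arm are few: the potential is an exponential martingale of
the observations from the arm, scaled by a geometric series. -/
theorem sum_lintegral_wrongDecision_le (c : ℝ) (T : ℕ) (i : Fin K) (hi : ν.mean i ≠ c) :
    ∑ t ∈ Finset.range T, ∫⁻ h, ∫⁻ a, (if a = i ∧ ν.wrongDecision c i h then 1 else 0)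
        ∂(π.select t h) ∂(π.law ν.armLaw t)
      ≤ ENNReal.ofReal (2 / (ν.mean i - c) ^ 2 + if ν.mean i ≤ c then 1 else 0) := by
  set δ := ν.mean i - c with hδ
  have hδ0 : δ ≠ 0 := sub_ne_zero.2 hi
  have hδ2 : 0 < δ ^ 2 := by positivity
  set e : ℝ := if ν.mean i ≤ c then 1 else 0 with he
  have he0 : 0 ≤ e := by rw [he]; split_ifs <;> norm_num
  -- q is the mean of exp(-δ(X - c)) for X from arm i, so each pull multiplies the conditional mean
  -- of exp(-δS) by q. The tilt -δ minimises this factor.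
  set q := Real.exp (-δ ^ 2 / 2) with hq
  have hq0 : 0 < q := Real.exp_pos _
  have hq1 : q < 1 := by rw [hq, Real.exp_lt_one_iff]; linarith
  have h1q : 0 < 1 - q := sub_pos.2 hq1
  have hqle : q / (1 - q) ≤ 2 / δ ^ 2 := by
    rw [div_le_div_iff₀ h1q hδ2]
    have h1 : δ ^ 2 / 2 + 1 ≤ Real.exp (δ ^ 2 / 2) := Real.add_one_le_exp _
    have h2 : q * Real.exp (δ ^ 2 / 2) = 1 := by
      rw [hq, ← Real.exp_add, Real.exp_eq_one_iff]; ring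
    nlinarith
  -- After a first pull, exp(-δS) ∑ₙ qⁿ bounds the expected future cost. Before it, the first
  -- decision costs at most e and the rest q/(1 - q); treating this case separately avoids paying 1
  -- when μᵢ > c.
  let U : (t : ℕ) → History (Fin K) t → ℝ := fun t h =>
    if pullCount h i = 0 then q / (1 - q) + e else Real.exp (-δ * centeredSum c i h) / (1 - q)
  have hUm : ∀ t, Measurable (U t) := fun t =>
    Measurable.ite (measurable_pullCount i (measurableSet_singleton 0)) measurable_const
      ((Real.measurable_exp.comp ((measurable_centeredSum c i t).const_mul _)).div_const _)
  have hD : ∀ t, Measurable fun p : History (Fin K) t × Fin K =>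
      if p.2 = i ∧ ν.wrongDecision c i p.1 then (1 : ENNReal) else 0 := fun t => by
    refine Measurable.ite (MeasurableSet.inter ?_ ?_) measurable_const measurable_const
    · exact measurableSet_eq_fun measurable_snd measurable_const
    · exact measurable_fst (ν.measurableSet_wrongDecision c t i)
  have main := π.sum_lintegral_le_of_drift ν.armLaw (fun t h => ENNReal.ofReal (U t h))
    (fun t => (hUm t).ennreal_ofReal)
    (fun t h a => if a = i ∧ ν.wrongDecision c i h then 1 else 0) hD ?_ T
  · refine main.trans (ENNReal.ofReal_le_ofReal ?_)
    simp only [U, pullCount_eq_sum, Finset.univ_eq_empty, Finset.sum_empty, if_true]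
    linarith
  · intro t h a
    by_cases ha : a = i
    · subst ha
      have hstep : ∫⁻ x, ENNReal.ofReal (U (t + 1) (History.append (h, (a, x)))) ∂(ν.armLaw a)
          = ENNReal.ofReal (Real.exp (-δ * centeredSum c a h) * (q / (1 - q))) := by
        have : ∀ x, ENNReal.ofReal (U (t + 1) (History.append (h, (a, x))))
            = ENNReal.ofReal (Real.exp (-δ * centeredSum c a h + δ * c) / (1 - q))
              * ENNReal.ofReal (Real.exp (-δ * x)) := fun x => by
          rw [← ENNReal.ofReal_mul (by positivity)]
          simp only [U, pullCount_append, centeredSum_append, if_true]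
          rw [if_neg (Nat.succ_ne_zero _), div_mul_eq_mul_div, ← Real.exp_add]
          congr 3
          ring
        simp_rw [this]
        rw [lintegral_const_mul _ (by fun_prop), ν.armLaw_apply, lintegral_exp_mul_gaussianReal,
          ← ENNReal.ofReal_mul (by positivity), hq, div_mul_eq_mul_div, mul_div_assoc',
          ← Real.exp_add,
          ← Real.exp_add]
        congr 3
        rw [hδ]; ring
      rw [hstep]
      have hD' : (if a = a ∧ ν.wrongDecision c a h then (1 : ENNReal) else 0)
          = ENNReal.ofReal (if ν.wrongDecision c a h then 1 else 0) := by
        by_cases hw : ν.wrongDecision c a h <;> simp [hw]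
      rw [hD', ← ENNReal.ofReal_add (by split_ifs <;> norm_num) (by positivity)]
      refine ENNReal.ofReal_le_ofReal ?_
      by_cases hN : pullCount h a = 0
      · have hS : centeredSum c a h = 0 := by
          refine Finset.sum_eq_zero fun s _ => if_neg fun hs => ?_
          rw [pullCount, Finset.card_eq_zero, Finset.filter_eq_empty_iff] at hN
          exact hN (Finset.mem_univ s) hs
        have hwe : (if ν.wrongDecision c a h then (1 : ℝ) else 0) ≤ e := by
          split_ifs with hw
          · rw [he, if_pos (ν.wrongDecision_of_pullCount_eq_zero hN hw)]
          · exact he0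
        simp only [U, hN, if_true, hS, mul_zero, Real.exp_zero, one_mul]
        linarith
      · have hwe : (if ν.wrongDecision c a h then (1 : ℝ) else 0)
            ≤ Real.exp (-δ * centeredSum c a h) := by
          split_ifs with hw
          · exact ν.one_le_exp_of_wrongDecision hN hw
          · positivity
        simp only [U, hN, if_false]
        have : Real.exp (-δ * centeredSum c a h) / (1 - q)
            = Real.exp (-δ * centeredSum c a h)
              + Real.exp (-δ * centeredSum c a h) * (q / (1 - q)) := by
          field_simp; ring
        linarith
    · have : ∀ x, U (t + 1) (History.append (h, (a, x))) = U t h := fun x => by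
        simp [U, pullCount_append, centeredSum_append, ha]
      simp [this, ha]

theorem expectedWrong_le (c : ℝ) (T : ℕ) (i : Fin K) (hi : ν.mean i ≠ c) :
    expectedWrong ν π c T i ≤ 2 / (ν.mean i - c) ^ 2 + if ν.mean i ≤ c then 1 else 0 := by
  classical
  have h0 : (0 : ℝ) ≤ 2 / (ν.mean i - c) ^ 2 + if ν.mean i ≤ c then 1 else 0 := by
    split_ifs <;> positivity
  rw [← ENNReal.ofReal_le_ofReal_iff h0]
  refine le_trans (le_of_eq ?_) (sum_lintegral_wrongDecision_le ν π c T i hi)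
  unfold expectedWrong
  have hn : ∀ (t : ℕ) (h : History (Fin K) t), 0 ≤ {h | ν.wrongDecision c i h}.indicator
      (fun h => π.pullProb t h i) h :=
    fun t h => Set.indicator_nonneg (fun h _ => π.pullProb_nonneg t h i) h
  rw [ENNReal.ofReal_sum_of_nonneg fun t _ => integral_nonneg (hn t)]
  refine Finset.sum_congr rfl fun t _ => ?_
  rw [ofReal_integral_eq_lintegral_ofReal ((π.integrable_pullProb ν t i).indicator
    (ν.measurableSet_wrongDecision c t i)) (ae_of_all _ (hn t))]
  refine lintegral_congr fun h => ?_
  rw [lintegral_fintype]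
  by_cases hw : ν.wrongDecision c i h
  · simp [hw, Policy.pullProb]
  · simp [hw]

end WrongDecisions

/-! ### Change of measure and the information inequality -/

theorem lintegral_gaussianReal_add (m d : ℝ) {f : ℝ → ENNReal} (hf : Measurable f) :
    ∫⁻ x, f x ∂(gaussianReal (m + d) 1)
      = ∫⁻ x, f x * ENNReal.ofReal (Real.exp (d * (x - m) - d ^ 2 / 2)) ∂(gaussianReal m 1) := by
  rw [gaussianReal_of_var_ne_zero _ one_ne_zero, gaussianReal_of_var_ne_zero _ one_ne_zero,
    lintegral_withDensity_eq_lintegral_mul _ (measurable_gaussianPDF _ _) hf,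
    lintegral_withDensity_eq_lintegral_mul _ (measurable_gaussianPDF _ _) (by fun_prop)]
  refine lintegral_congr fun x => ?_
  have : gaussianPDF (m + d) 1 x
      = gaussianPDF m 1 x * ENNReal.ofReal (Real.exp (d * (x - m) - d ^ 2 / 2)) := by
    unfold gaussianPDF gaussianPDFReal
    rw [← ENNReal.ofReal_mul (by positivity), mul_assoc (√_)⁻¹, ← Real.exp_add]
    congr 3
    push_cast
    ring
  simp only [Pi.mul_apply, this]
  ring

section ChangeOfMeasure

variable {K : ℕ} (ν ν' : Instance K) (π : Policy (Fin K))

/-- The log-likelihood ratio of one round when the mean of arm `i` is raised from `m` to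
`m + d`. -/
def logLikelihoodStep (i : Fin K) (m d : ℝ) (z : Fin K × ℝ) : ℝ :=
  if z.1 = i then d * (z.2 - m) - d ^ 2 / 2 else 0

theorem measurable_logLikelihoodStep (i : Fin K) (m d : ℝ) :
    Measurable (logLikelihoodStep i m d) :=
  Measurable.ite (measurableSet_eq_fun (by fun_prop) measurable_const) (by fun_prop)
    measurable_const

/-- Change of measure between two instances that differ in the mean of one arm. -/
theorem lintegral_law_of_mean_eq_update {i : Fin K} {d : ℝ}
    (hν' : ν'.mean = Function.update ν.mean i (ν.mean i + d)) (T : ℕ)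
    {f : History (Fin K) T → ENNReal} (hf : Measurable f) :
    ∫⁻ h, f h ∂(π.law ν'.armLaw T) = ∫⁻ h, f h * ENNReal.ofReal
      (Real.exp (∑ s, logLikelihoodStep i (ν.mean i) d (h s))) ∂(π.law ν.armLaw T) := by
  have hLm : ∀ t, Measurable fun h : History (Fin K) t => ENNReal.ofReal
      (Real.exp (∑ s, logLikelihoodStep i (ν.mean i) d (h s))) := fun t =>
    (Real.measurable_exp.comp
      (measurable_sum_history (measurable_logLikelihoodStep i _ d))).ennreal_ofReal
  have hfL : ∀ (t : ℕ) (f : History (Fin K) t → ENNReal), Measurable f →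
      Measurable fun h => f h * ENNReal.ofReal
        (Real.exp (∑ s, logLikelihoodStep i (ν.mean i) d (h s))) := fun t f hf => hf.mul (hLm t)
  induction T with
  | zero =>
    rw [Policy.lintegral_law_zero _ _ hf, Policy.lintegral_law_zero _ _ (hfL _ f hf)]
    simp
  | succ T ih =>
    have hfa : Measurable fun p : (History (Fin K) T × Fin K) × ℝ =>
        f (History.append (p.1.1, (p.1.2, p.2))) :=
      hf.comp (History.measurable_append.comp (by fun_prop))
    have hin : Measurable fun p : History (Fin K) T × Fin K =>
        ∫⁻ x, f (History.append (p.1, (p.2, x))) ∂(ν'.armLaw p.2) := by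
      have := hfa.lintegral_kernel_prod_right'
        (κ := Kernel.prodMkLeft (History (Fin K) T) ν'.armLaw)
      simpa [Kernel.prodMkLeft_apply] using this
    rw [Policy.lintegral_law_succ _ _ _ hf, Policy.lintegral_law_succ _ _ _ (hfL _ f hf),
      ih hin.lintegral_kernel_prod_right']
    refine lintegral_congr fun h => ?_
    have hinh : Measurable fun a => ∫⁻ x, f (History.append (h, (a, x))) ∂(ν'.armLaw a) :=
      measurable_of_countable _
    dsimp only
    rw [← lintegral_mul_const _ hinh]
    refine lintegral_congr fun a => ?_
    have hfx : Measurable fun x => f (History.append (h, (a, x))) :=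
      hfa.comp (measurable_prodMk_left (x := (h, a)))
    simp_rw [sum_append]
    -- The policy kernel is common to both instances, so only a pull of arm i contributes a
    -- likelihood factor.
    by_cases ha : a = i
    · subst ha
      have hfx' : Measurable fun x => f (History.append (h, (a, x)))
          * ENNReal.ofReal (Real.exp (d * (x - ν.mean a) - d ^ 2 / 2)) := hfx.mul (by fun_prop)
      rw [ν'.armLaw_apply, ν.armLaw_apply, hν', Function.update_self,
        lintegral_gaussianReal_add _ _ hfx,
        ← lintegral_mul_const _ hfx']
      refine lintegral_congr fun x => ?_
      rw [Real.exp_add, ENNReal.ofReal_mul (Real.exp_pos _).le]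
      simp only [logLikelihoodStep, if_true]
      ring
    · rw [ν'.armLaw_apply, ν.armLaw_apply, hν', Function.update_of_ne ha]
      simp only [logLikelihoodStep, ha, if_false, add_zero]
      rw [lintegral_mul_const _ hfx]

theorem integrable_pullCount (T : ℕ) (i : Fin K) :
    Integrable (fun h => (pullCount h i : ℝ)) (π.law ν.armLaw T) := by
  refine Integrable.of_bound
    ((measurable_from_top (f := fun n : ℕ => (n : ℝ))).comp
      (measurable_pullCount i)).aestronglyMeasurable T (ae_of_all _ fun h => ?_)
  rw [Real.norm_of_nonneg (Nat.cast_nonneg _)]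
  exact_mod_cast (Finset.card_filter_le _ _).trans (by simp)

theorem pullCount_le {t : ℕ} (h : History (Fin K) t) (i : Fin K) : pullCount h i ≤ t :=
  (Finset.card_filter_le _ _).trans (by simp)

theorem integral_pullCount (T : ℕ) (i : Fin K) :
    ∫ h, (pullCount h i : ℝ) ∂(π.law ν.armLaw T) = expectedPulls ν π T i := by
  have hr : ∀ a, (fun x : ℝ => if (a, x).1 = i then (1 : ℝ) else 0)
      = fun _ => if a = i then 1 else 0 := fun a => rfl
  have := integral_sum_history_arms ν π (g := fun z => if z.1 = i then 1 else 0)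
    (Measurable.ite (measurableSet_eq_fun (by fun_prop) measurable_const) measurable_const
      measurable_const) (fun a => by rw [hr]; exact integrable_const _) T
  simp_rw [hr] at this
  simp_rw [pullCount_eq_sum]
  push_cast
  rw [this]
  simp

theorem integrable_logLikelihoodStep (i a : Fin K) (m d : ℝ) :
    Integrable (fun x => logLikelihoodStep i m d (a, x)) (ν.armLaw a) := by
  unfold logLikelihoodStep
  by_cases ha : a = i
  · simp only [ha, if_true]
    exact (((integrable_id_gaussianReal_one _).sub (integrable_const _)).const_mul _).sub
      (integrable_const _)
  · simp [ha]

/-- This is minus the relative entropy of the two history laws: each pull of arm i contributes the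
divergence d²/2 between unit-variance Gaussians at distance d. -/
theorem integral_sum_logLikelihoodStep (T : ℕ) (i : Fin K) (d : ℝ) :
    ∫ h, ∑ s, logLikelihoodStep i (ν.mean i) d (h s) ∂(π.law ν.armLaw T)
      = -(expectedPulls ν π T i * (d ^ 2 / 2)) := by
  rw [integral_sum_history_arms ν π (measurable_logLikelihoodStep i _ d)
    (fun a => integrable_logLikelihoodStep ν i a _ d), Finset.sum_eq_single i]
  · have h1 : Integrable (fun x => d * (x - ν.mean i)) (gaussianReal (ν.mean i) 1) :=
      ((integrable_id_gaussianReal_one _).sub (integrable_const _)).const_mul _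
    simp only [logLikelihoodStep, if_true, ν.armLaw_apply]
    rw [integral_sub h1 (integrable_const _), integral_const_mul,
      integral_sub (integrable_id_gaussianReal_one _) (integrable_const _),
      integral_id_gaussianReal]
    simp
  · intro a _ ha
    simp [logLikelihoodStep, ha]
  · simp

/-- Information lower bound: an arm must be pulled often under `ν` if it is pulled almost always
under an instance that differs from `ν` by `d` in the mean of this arm. -/
theorem le_expectedPulls_of_mean_eq_update {i : Fin K} {d : ℝ}
    (hν' : ν'.mean = Function.update ν.mean i (ν.mean i + d)) {T : ℕ} (hT : 0 < T) (l : ℝ) :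
    l * (1 - expectedPulls ν π T i / T) - Real.exp l * (1 - expectedPulls ν' π T i / T)
      ≤ expectedPulls ν π T i * (d ^ 2 / 2) := by
  have hT' : (0 : ℝ) < T := by exact_mod_cast hT
  let G : History (Fin K) T → ℝ := fun h => 1 - pullCount h i / T
  let ℓ : History (Fin K) T → ℝ := fun h => ∑ s, logLikelihoodStep i (ν.mean i) d (h s)
  have hG0 : ∀ h, 0 ≤ G h := fun h => by
    have : (pullCount h i : ℝ) ≤ T := by exact_mod_cast pullCount_le h i
    simp only [G]
    rw [sub_nonneg, div_le_one hT']
    exact this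
  have hG1 : ∀ h, G h ≤ 1 := fun h => by
    simp only [G, sub_le_self_iff]
    positivity
  have hGm : Measurable G := measurable_const.sub
    (((measurable_from_top (f := fun n : ℕ => (n : ℝ))).comp (measurable_pullCount i)).div_const _)
  have hℓm : Measurable ℓ := measurable_sum_history (measurable_logLikelihoodStep i _ d)
  have hGi : ∀ ρ : Instance K, Integrable G (π.law ρ.armLaw T) := fun ρ =>
    (integrable_const _).sub ((integrable_pullCount ρ π T i).div_const _)
  have hGe : ∀ ρ : Instance K, ∫ h, G h ∂(π.law ρ.armLaw T) = 1 - expectedPulls ρ π T i / T :=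
    fun ρ => by
      simp only [G]
      rw [integral_sub (integrable_const _) ((integrable_pullCount ρ π T i).div_const _),
        integral_div, integral_pullCount]
      simp
  obtain ⟨C, hC⟩ := exists_lintegral_enorm_le ν.armLaw
    (fun a => integrable_logLikelihoodStep ν i a (ν.mean i) d)
  have hℓi : Integrable ℓ (π.law ν.armLaw T) :=
    π.integrable_sum_history ν.armLaw (measurable_logLikelihoodStep i _ d) hC T
  -- On [0, 1] the convex function exp(l ·) lies below its chord 1 + (exp l - 1) G.
  have hexp : ∀ h, Real.exp (l * G h) ≤ 1 + Real.exp l * G h := fun h => by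
    have := convexOn_exp.2 (Set.mem_univ l) (Set.mem_univ 0) (hG0 h)
      (sub_nonneg.2 (hG1 h)) (by ring)
    simp only [smul_eq_mul, mul_zero, add_zero, Real.exp_zero, mul_one] at this
    rw [mul_comm l]
    nlinarith [hG0 h]
  have hei : Integrable (fun h => 1 + Real.exp l * G h) (π.law ν'.armLaw T) :=
    (integrable_const _).add ((hGi ν').const_mul _)
  have hlint : ∫⁻ h, ENNReal.ofReal (Real.exp (l * G h + ℓ h)) ∂(π.law ν.armLaw T)
      ≤ ENNReal.ofReal (1 + Real.exp l * (1 - expectedPulls ν' π T i / T)) := by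
    have h1 := lintegral_law_of_mean_eq_update ν ν' π hν' T
      (f := fun h => ENNReal.ofReal (Real.exp (l * G h)))
      (Real.measurable_exp.comp (hGm.const_mul l)).ennreal_ofReal
    have h2 : ∫⁻ h, ENNReal.ofReal (Real.exp (l * G h + ℓ h)) ∂(π.law ν.armLaw T)
        = ∫⁻ h, ENNReal.ofReal (Real.exp (l * G h)) ∂(π.law ν'.armLaw T) := by
      rw [h1]
      refine lintegral_congr fun h => ?_
      rw [Real.exp_add, ENNReal.ofReal_mul (Real.exp_pos _).le]
    rw [h2]
    calc _ ≤ ∫⁻ h, ENNReal.ofReal (1 + Real.exp l * G h) ∂(π.law ν'.armLaw T) :=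
          lintegral_mono fun h => ENNReal.ofReal_le_ofReal (hexp h)
      _ = _ := by
          rw [← ofReal_integral_eq_lintegral_ofReal hei
            (ae_of_all _ fun h => (Real.exp_pos _).le.trans (hexp h)),
            integral_add (integrable_const _) ((hGi ν').const_mul _), integral_const_mul, hGe]
          simp
  have hem : Measurable fun h => Real.exp (l * G h + ℓ h) :=
    Real.measurable_exp.comp ((hGm.const_mul l).add hℓm)
  have hint : Integrable (fun h => Real.exp (l * G h + ℓ h)) (π.law ν.armLaw T) := by
    refine ⟨hem.aestronglyMeasurable, ?_⟩
    rw [hasFiniteIntegral_iff_ofReal (ae_of_all _ fun h => (Real.exp_pos _).le)]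
    exact hlint.trans_lt ENNReal.ofReal_lt_top
  have hnn : 0 ≤ 1 + Real.exp l * (1 - expectedPulls ν' π T i / T) := by
    rw [← hGe ν']
    have : 0 ≤ ∫ h, G h ∂(π.law ν'.armLaw T) := integral_nonneg hG0
    positivity
  have hE : ∫ h, Real.exp (l * G h + ℓ h) ∂(π.law ν.armLaw T)
      ≤ 1 + Real.exp l * (1 - expectedPulls ν' π T i / T) := by
    rw [← ENNReal.ofReal_le_ofReal_iff hnn, ofReal_integral_eq_lintegral_ofReal hint
      (ae_of_all _ fun h => (Real.exp_pos _).le)]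
    exact hlint
  have hsum : Integrable (fun h => l * G h + ℓ h) (π.law ν.armLaw T) :=
    ((hGi ν).const_mul l).add hℓi
  -- The Donsker–Varadhan bound in linearised form: 1 + x ≤ exp x replaces Jensen's inequality, and
  -- the 1 cancels against the one from the chord.
  have hlin : ∫ h, (l * G h + ℓ h + 1) ∂(π.law ν.armLaw T)
      ≤ ∫ h, Real.exp (l * G h + ℓ h) ∂(π.law ν.armLaw T) :=
    integral_mono (hsum.add (integrable_const _)) hint
      fun h => Real.add_one_le_exp _
  rw [integral_add hsum (integrable_const _),
    integral_add ((hGi ν).const_mul l) hℓi, integral_const_mul, hGe,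
    integral_sum_logLikelihoodStep] at hlin
  simp only [integral_const, probReal_univ, one_smul] at hlin
  linarith

end ChangeOfMeasure

/-! ### The Lai–Robbins rate of each arm -/

/-- If one term exceeded its limit, the others, being almost at least theirs, could not compensate
in the sum. -/
theorem tendsto_of_tendsto_sum_of_eventually_lt {ι β : Type*} {s : Finset ι} {F : Filter β}
    {a : ι → β → ℝ} {l : ι → ℝ} (hsum : Tendsto (fun x => ∑ i ∈ s, a i x) F (nhds (∑ i ∈ s, l i)))
    (hlow : ∀ i ∈ s, ∀ m < l i, ∀ᶠ x in F, m < a i x) {i : ι} (hi : i ∈ s) :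
    Tendsto (a i) F (nhds (l i)) := by
  classical
  refine tendsto_order.2 ⟨hlow i hi, fun u hu => ?_⟩
  -- The slack ε is spent once on the sum and once on each other term, `s.card` times in all; the
  -- added 1 makes n positive at once.
  set n : ℝ := s.card + 1 with hn
  have hn0 : 0 < n := by positivity
  set ε := (u - l i) / n with hε
  have hε0 : 0 < ε := div_pos (sub_pos.2 hu) hn0
  have h1 : ∀ᶠ x in F, ∀ j ∈ s, l j - ε < a j x :=
    (Filter.eventually_all_finset s).2 fun j hj => hlow j hj _ (by linarith)
  filter_upwards [h1, hsum.eventually (gt_mem_nhds (lt_add_of_pos_right _ hε0))] with x hx1 hx2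
  rw [← Finset.add_sum_erase s _ hi, ← Finset.add_sum_erase s l hi] at hx2
  have h3 : ∑ j ∈ s.erase i, (l j - ε) ≤ ∑ j ∈ s.erase i, a j x :=
    Finset.sum_le_sum fun j hj => (hx1 j (Finset.mem_of_mem_erase hj)).le
  rw [Finset.sum_sub_distrib, Finset.sum_const, Finset.card_erase_of_mem hi, nsmul_eq_mul,
    Nat.cast_sub (Finset.card_pos.2 ⟨i, hi⟩)] at h3
  have h4 : n * ε = u - l i := mul_div_cancel₀ _ hn0.ne'
  push_cast at h3
  nlinarith

section LowerBound

variable {K : ℕ} (ν : Instance K)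

theorem Instance.mean_le_mean_best (i : Fin K) : ν.mean i ≤ ν.mean ν.best := by
  by_cases h : i = ν.best
  · rw [h]
  · exact (ν.best_unique i h).le

theorem Instance.gap_nonneg (i : Fin K) : 0 ≤ ν.gap i := sub_nonneg.2 (ν.mean_le_mean_best i)

theorem Instance.gap_pos {i : Fin K} (hi : i ≠ ν.best) : 0 < ν.gap i :=
  sub_pos.2 (ν.best_unique i hi)

theorem Instance.gap_best : ν.gap ν.best = 0 := sub_self _

/-- The instance in which the mean of arm `i` is raised to `ε` above the best mean. -/
def Instance.raise (i : Fin K) {ε : ℝ} (hε : 0 < ε) : Instance K where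
  mean := Function.update ν.mean i (ν.mean i + (ν.gap i + ε))
  best := i
  best_unique j hj := by
    rw [Function.update_of_ne hj, Function.update_self]
    have := ν.mean_le_mean_best j
    unfold Instance.gap
    linarith

theorem Instance.le_gap_raise {i j : Fin K} {ε : ℝ} (hε : 0 < ε) (hj : j ≠ i) :
    ε ≤ (ν.raise i hε).gap j := by
  simp only [Instance.gap, Instance.raise, Function.update_of_ne hj, Function.update_self]
  have := ν.mean_le_mean_best j
  linarith

theorem gap_mul_expectedPulls_le_canonicalRegret (π : Policy (Fin K)) (T : ℕ) (i : Fin K) :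
    ν.gap i * expectedPulls ν π T i ≤ canonicalRegret ν T π := by
  rw [canonicalRegret_eq]
  exact Finset.single_le_sum (f := fun i => ν.gap i * expectedPulls ν π T i)
    (fun i _ => mul_nonneg (ν.gap_nonneg i) (expectedPulls_nonneg ν π T i)) (Finset.mem_univ i)

/-- In the raised instance every round off arm i costs at least ε, so small regret there forces arm
i to be pulled almost always. -/
theorem mul_sub_expectedPulls_le_canonicalRegret (i : Fin K) {ε : ℝ} (hε : 0 < ε)
    (π : Policy (Fin K)) (T : ℕ) :
    ε * (T - expectedPulls (ν.raise i hε) π T i) ≤ canonicalRegret (ν.raise i hε) T π := by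
  rw [canonicalRegret_eq, ← sum_expectedPulls (ν.raise i hε) π T,
    ← Finset.add_sum_erase _ _ (Finset.mem_univ i), add_sub_cancel_left,
    ← Finset.add_sum_erase _ _ (Finset.mem_univ i), Finset.mul_sum]
  have h0 : 0 ≤ (ν.raise i hε).gap i * expectedPulls (ν.raise i hε) π T i :=
    mul_nonneg (Instance.gap_nonneg _ i) (expectedPulls_nonneg _ π T i)
  have h1 : ∑ j ∈ Finset.univ.erase i, ε * expectedPulls (ν.raise i hε) π T j
      ≤ ∑ j ∈ Finset.univ.erase i, (ν.raise i hε).gap j * expectedPulls (ν.raise i hε) π T j :=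
    Finset.sum_le_sum fun j hj => mul_le_mul_of_nonneg_right
      (ν.le_gap_raise hε (Finset.ne_of_mem_erase hj)) (expectedPulls_nonneg _ π T j)
  linarith

variable {ν} {ALG : Algorithm K}

theorem tendsto_log_natCast_div_atTop :
    Tendsto (fun T : ℕ => Real.log T / T) atTop (nhds 0) :=
  (Real.isLittleO_log_id_atTop.tendsto_div_nhds_zero).comp tendsto_natCast_atTop_atTop

theorem log_natCast_pos_of_two_le {T : ℕ} (hT : 2 ≤ T) : 0 < Real.log T :=
  Real.log_pos (by exact_mod_cast hT)

theorem IsAsymptoticallyOptimal.tendsto_expectedPulls_div (h : IsAsymptoticallyOptimal ALG)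
    {i : Fin K} (hi : i ≠ ν.best) :
    Tendsto (fun T : ℕ => expectedPulls ν (ALG T) T i / T) atTop (nhds 0) := by
  have hg := ν.gap_pos hi
  have hR := ((h ν).mul tendsto_log_natCast_div_atTop).div_const (ν.gap i)
  rw [mul_zero, zero_div] at hR
  refine tendsto_of_tendsto_of_tendsto_of_le_of_le' tendsto_const_nhds hR
    (Eventually.of_forall fun T => div_nonneg (expectedPulls_nonneg _ _ T i) (Nat.cast_nonneg T))
    ?_
  filter_upwards [eventually_ge_atTop 2] with T hT
  have hlog := log_natCast_pos_of_two_le hT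
  have hT0 : (0 : ℝ) < T := by positivity
  rw [div_mul_div_cancel₀ hlog.ne', div_div, mul_comm (T : ℝ), ← div_div]
  gcongr
  rw [le_div_iff₀ hg, mul_comm]
  exact gap_mul_expectedPulls_le_canonicalRegret ν (ALG T) T i

/-- The Lai–Robbins lower bound. -/
theorem IsAsymptoticallyOptimal.eventually_lt_expectedPulls_div_log
    (h : IsAsymptoticallyOptimal ALG) {i : Fin K} (hi : i ≠ ν.best) {m : ℝ}
    (hm : m < 2 / ν.gap i ^ 2) :
    ∀ᶠ T : ℕ in atTop, m < expectedPulls ν (ALG T) T i / Real.log T := by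
  have hg := ν.gap_pos hi
  -- ε is both the margin of the raised mean and the loss in the exponent; continuity at 0 keeps the
  -- resulting rate above m.
  obtain ⟨ε, hmε, hε⟩ : ∃ ε, m < 2 * (1 - ε) / (ν.gap i + ε) ^ 2 ∧ 0 < ε := by
    have hc : ContinuousAt (fun ε : ℝ => 2 * (1 - ε) / (ν.gap i + ε) ^ 2) 0 := by
      refine ContinuousAt.div (by fun_prop) (by fun_prop) ?_
      simp [hg.ne']
    have h1 : ∀ᶠ ε in nhds (0 : ℝ), m < 2 * (1 - ε) / (ν.gap i + ε) ^ 2 :=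
      hc.eventually (lt_mem_nhds (by simpa using hm))
    exact ((h1.filter_mono nhdsWithin_le_nhds).and
      (self_mem_nhdsWithin (s := Set.Ioi (0 : ℝ)))).exists
  set d := ν.gap i + ε with hd
  have hd0 : 0 < d := by positivity
  have hpow : Tendsto (fun T : ℕ => (T : ℝ) ^ (-ε)) atTop (nhds 0) :=
    (tendsto_rpow_neg_atTop hε).comp tendsto_natCast_atTop_atTop
  have hlim : Tendsto (fun T : ℕ => ((1 - ε) * (1 - expectedPulls ν (ALG T) T i / T)
      - (T : ℝ) ^ (-ε) * (canonicalRegret (ν.raise i hε) T (ALG T) / Real.log T / ε))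
        * (2 / d ^ 2)) atTop (nhds (((1 - ε) * (1 - 0) - 0 * (_ / ε)) * (2 / d ^ 2))) :=
    ((((h.tendsto_expectedPulls_div hi).const_sub 1).const_mul _).sub
      (hpow.mul ((h (ν.raise i hε)).div_const ε))).mul_const _
  have hm' : m < ((1 - ε) * (1 - 0) - 0 * ((∑ j ∈ Finset.univ.erase (ν.raise i hε).best,
      2 / (ν.raise i hε).gap j) / ε)) * (2 / d ^ 2) := by
    convert hmε using 1
    ring
  filter_upwards [hlim.eventually (lt_mem_nhds hm'), eventually_ge_atTop 2] with T hlt hT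
  refine hlt.trans_le ?_
  have hlog := log_natCast_pos_of_two_le hT
  have hT0 : (0 : ℝ) < T := by positivity
  -- With l = (1 - ε) log T, the error term is at most T^(-ε) times the raised regret over ε. That
  -- regret is O(log T), so the error vanishes even after division by log T.
  have key := le_expectedPulls_of_mean_eq_update ν (ν.raise i hε) (ALG T) (i := i) (d := d) rfl
    (T := T) (by omega) ((1 - ε) * Real.log T)
  have hexp : Real.exp ((1 - ε) * Real.log T) = T * (T : ℝ) ^ (-ε) := by
    rw [mul_comm, ← Real.rpow_def_of_pos hT0, sub_eq_add_neg, Real.rpow_add hT0, Real.rpow_one]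
  have hreg := mul_sub_expectedPulls_le_canonicalRegret ν i hε (ALG T) T
  have hpos : 0 < (T : ℝ) ^ (-ε) := Real.rpow_pos_of_pos hT0 _
  have h2 : Real.exp ((1 - ε) * Real.log T) * (1 - expectedPulls (ν.raise i hε) (ALG T) T i / T)
      ≤ (T : ℝ) ^ (-ε) * (canonicalRegret (ν.raise i hε) T (ALG T) / ε) := by
    rw [hexp, mul_right_comm, mul_comm]
    have : (T : ℝ) * (1 - expectedPulls (ν.raise i hε) (ALG T) T i / T)
        = T - expectedPulls (ν.raise i hε) (ALG T) T i := by field_simp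
    rw [this]
    gcongr
    rw [le_div_iff₀ hε, mul_comm]
    exact hreg
  rw [le_div_iff₀ hlog]
  have h3 : ((1 - ε) * (1 - expectedPulls ν (ALG T) T i / T)
      - (T : ℝ) ^ (-ε) * (canonicalRegret (ν.raise i hε) T (ALG T) / Real.log T / ε))
        * (2 / d ^ 2) * Real.log T
      = ((1 - ε) * Real.log T * (1 - expectedPulls ν (ALG T) T i / T)
      - (T : ℝ) ^ (-ε) * (canonicalRegret (ν.raise i hε) T (ALG T) / ε)) * (2 / d ^ 2) := by
    field_simp
  rw [h3]
  calc _ ≤ (expectedPulls ν (ALG T) T i * (d ^ 2 / 2)) * (2 / d ^ 2) := by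
        gcongr
        linarith
    _ = _ := by field_simp

/-- An asymptotically optimal algorithm pulls every suboptimal arm at the Lai–Robbins rate. -/
theorem IsAsymptoticallyOptimal.tendsto_expectedPulls_div_log
    (h : IsAsymptoticallyOptimal ALG) {i : Fin K} (hi : i ≠ ν.best) :
    Tendsto (fun T : ℕ => expectedPulls ν (ALG T) T i / Real.log T) atTop
      (nhds (2 / ν.gap i ^ 2)) := by
  have hsum := h ν
  have hR : ∀ T : ℕ, canonicalRegret ν T (ALG T) / Real.log T = ∑ i ∈ Finset.univ.erase ν.best,
      ν.gap i * (expectedPulls ν (ALG T) T i / Real.log T) := fun T => by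
    rw [canonicalRegret_eq, ← Finset.add_sum_erase _ _ (Finset.mem_univ ν.best), ν.gap_best,
      zero_mul, zero_add, Finset.sum_div]
    exact Finset.sum_congr rfl fun i _ => mul_div_assoc _ _ _
  simp_rw [hR] at hsum
  have hg := ν.gap_pos hi
  -- The terms are Δⱼ 𝔼Nⱼ / log T, with limits 2/Δⱼ; the factor Δᵢ is divided out afterwards.
  have := (tendsto_of_tendsto_sum_of_eventually_lt hsum (fun j hj m hm => ?_)
    (Finset.mem_erase.2 ⟨hi, Finset.mem_univ i⟩)).const_mul (ν.gap i)⁻¹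
  · refine (this.congr fun T => ?_).trans (le_of_eq ?_)
    · rw [inv_mul_cancel_left₀ hg.ne']
    · have hl : (ν.gap i)⁻¹ * (2 / ν.gap i) = 2 / ν.gap i ^ 2 := by field_simp
      exact congrArg nhds hl
  · have hj' := Finset.ne_of_mem_erase hj
    have hgj := ν.gap_pos hj'
    have hm' : m / ν.gap j < 2 / ν.gap j ^ 2 := by
      rw [div_lt_iff₀ hgj]
      have hl : 2 / ν.gap j ^ 2 * ν.gap j = 2 / ν.gap j := by field_simp
      exact hl ▸ hm
    filter_upwards [h.eventually_lt_expectedPulls_div_log hj' hm'] with T hT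
    rwa [div_lt_iff₀' hgj] at hT

end LowerBound

/-! ### Regret bounds for the wrapped algorithm -/

section Wrapper

variable {K : ℕ} (ν : Instance K) (π : Policy (Fin K))

/-- Truncation at c is nonexpansive; hence the first sum of the decomposition is at most the
canonical regret. -/
theorem max_sub_max_le_gap (c : ℝ) (i : Fin K) :
    max (ν.mean ν.best) c - max (ν.mean i) c ≤ ν.gap i := by
  have := ν.mean_le_mean_best i
  unfold Instance.gap
  rcases le_total (ν.mean ν.best) c with h | h
  · rw [max_eq_right h, max_eq_right (this.trans h)]
    linarith
  · rw [max_eq_left h]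
    linarith [le_max_left (ν.mean i) c]

theorem abs_mul_expectedWrong_le (c : ℝ) (T : ℕ) (i : Fin K) :
    |ν.mean i - c| * expectedWrong ν π c T i
      ≤ 2 / |ν.mean i - c| + if ν.mean i ≤ c then c - ν.mean i else 0 := by
  -- At equality no count of wrong decisions is needed: the weight is zero, and so is the right side
  -- because 2 / 0 = 0.
  by_cases hi : ν.mean i = c
  · simp [hi]
  have h0 : 0 < |ν.mean i - c| := abs_pos.2 (sub_ne_zero.2 hi)
  calc _ ≤ |ν.mean i - c| * (2 / (ν.mean i - c) ^ 2 + if ν.mean i ≤ c then 1 else 0) := by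
        gcongr
        exact expectedWrong_le ν π c T i hi
    _ = _ := by
        rw [mul_add, ← sq_abs]
        congr 1
        · field_simp
        · split_ifs with h
          · rw [abs_of_nonpos (sub_nonpos.2 h)]; ring
          · simp

theorem fixedRewardRegret_le_of_canonicalRegret_le {α₁ : ℝ} (hα₁ : 0 < α₁) (c : ℝ) (T : ℕ)
    (h : canonicalRegret ν T π
      ≤ α₁ * (√((K : ℝ) * T) + ∑ i ∈ Finset.univ.erase ν.best, ν.gap i)) :
    fixedRewardRegret ν c T (withAbstention c π)
      ≤ (α₁ + 3) * (√((K : ℝ) * T) + ∑ i, (max (ν.mean ν.best) c - ν.mean i)) := by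
  have hnn : ∀ i, 0 ≤ max (ν.mean ν.best) c - ν.mean i := fun i =>
    sub_nonneg.2 ((ν.mean_le_mean_best i).trans (le_max_left _ _))
  have hS : 0 ≤ ∑ i, (max (ν.mean ν.best) c - ν.mean i) := Finset.sum_nonneg fun i _ => hnn i
  have hgap : ∑ i ∈ Finset.univ.erase ν.best, ν.gap i
      ≤ ∑ i, (max (ν.mean ν.best) c - ν.mean i) :=
    (Finset.sum_le_sum fun i _ => sub_le_sub_right (le_max_left _ c) _).trans
      (Finset.sum_le_sum_of_subset_of_nonneg (Finset.erase_subset _ _) fun i _ _ => hnn i)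
  have hfirst : ∑ i, (max (ν.mean ν.best) c - max (ν.mean i) c) * expectedPulls ν π T i
      ≤ α₁ * (√((K : ℝ) * T) + ∑ i, (max (ν.mean ν.best) c - ν.mean i)) := by
    refine le_trans ?_ (h.trans (by gcongr))
    rw [canonicalRegret_eq]
    exact Finset.sum_le_sum fun i _ => mul_le_mul_of_nonneg_right (max_sub_max_le_gap ν c i)
      (expectedPulls_nonneg ν π T i)
  have hsecond : ∑ i, |ν.mean i - c| * expectedWrong ν π c T i
      ≤ 3 * √((K : ℝ) * T) + ∑ i, (max (ν.mean ν.best) c - ν.mean i) := by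
    rcases Nat.eq_zero_or_pos T with rfl | hT
    · simp only [expectedWrong, Finset.range_zero, Finset.sum_empty, mul_zero,
        Finset.sum_const_zero]
      positivity
    have hT0 : (0 : ℝ) < T := by exact_mod_cast hT
    have hK0 : (0 : ℝ) < K := by exact_mod_cast ν.best.pos
    set r := √((K : ℝ) * T) with hr
    have hr0 : 0 < r := Real.sqrt_pos.2 (by positivity)
    have hr2 : r * r = K * T := Real.mul_self_sqrt (by positivity)
    -- The threshold r / T is √(K/T). The three summands cover arms near c, arms far from c, and the
    -- cost of a first pull; over all arms the first two add up to r and 2r, whence the 3.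
    have hterm : ∀ i, |ν.mean i - c| * expectedWrong ν π c T i
        ≤ r / T * expectedPulls ν π T i + 2 * (r / K) + (max (ν.mean ν.best) c - ν.mean i) := by
      intro i
      have hEN := expectedPulls_nonneg ν π T i
      rcases le_total |ν.mean i - c| (r / T) with hs | hs
      · have : |ν.mean i - c| * expectedWrong ν π c T i ≤ r / T * expectedPulls ν π T i :=
          mul_le_mul hs (expectedWrong_le_expectedPulls ν π c T i)
            (expectedWrong_nonneg ν π c T i) (by positivity)
        have : 0 ≤ 2 * (r / K) := by positivity
        linarith [hnn i]
      · have h1 := abs_mul_expectedWrong_le ν π c T i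
        have h2 : 2 / |ν.mean i - c| ≤ 2 * (r / K) := by
          calc _ ≤ 2 / (r / T) := by gcongr
            _ = 2 * (r / K) := by
              field_simp
              nlinarith
        have h3 : (if ν.mean i ≤ c then c - ν.mean i else 0)
            ≤ max (ν.mean ν.best) c - ν.mean i := by
          split_ifs
          · exact sub_le_sub_right (le_max_right _ _) _
          · exact hnn i
        have : 0 ≤ r / T * expectedPulls ν π T i := by positivity
        linarith
    refine (Finset.sum_le_sum fun i _ => hterm i).trans (le_of_eq ?_)
    rw [Finset.sum_add_distrib, Finset.sum_add_distrib, ← Finset.mul_sum, sum_expectedPulls]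
    simp only [Finset.sum_const, Finset.card_univ, Fintype.card_fin, nsmul_eq_mul]
    field_simp
    ring
  rw [fixedRewardRegret_eq]
  nlinarith

theorem IsAsymptoticallyOptimal.limsup_fixedRewardRegret_le {ALG : Algorithm K}
    (h : IsAsymptoticallyOptimal ALG) (c : ℝ) :
    limsup (fun T : ℕ => ((fixedRewardRegret ν c T (withAbstention c (ALG T)) / Real.log T : ℝ)
        : EReal)) atTop
      ≤ ((2 * ∑ i ∈ Finset.univ.erase ν.best,
          (max (ν.mean ν.best) c - max (ν.mean i) c) / ν.gap i ^ 2 : ℝ) : EReal) := by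
  set C := ∑ i, (2 / |ν.mean i - c| + if ν.mean i ≤ c then c - ν.mean i else 0)
  have hlim : Tendsto (fun T : ℕ => ∑ i ∈ Finset.univ.erase ν.best,
      (max (ν.mean ν.best) c - max (ν.mean i) c) * (expectedPulls ν (ALG T) T i / Real.log T)
        + C / Real.log T) atTop (nhds (∑ i ∈ Finset.univ.erase ν.best,
      (max (ν.mean ν.best) c - max (ν.mean i) c) * (2 / ν.gap i ^ 2) + 0)) := by
    refine Tendsto.add (tendsto_finsetSum _ fun i hi => ?_)
      (Tendsto.div_atTop tendsto_const_nhds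
        (Real.tendsto_log_atTop.comp tendsto_natCast_atTop_atTop))
    exact (h.tendsto_expectedPulls_div_log (Finset.ne_of_mem_erase hi)).const_mul _
  have hval : ∑ i ∈ Finset.univ.erase ν.best,
      (max (ν.mean ν.best) c - max (ν.mean i) c) * (2 / ν.gap i ^ 2) + 0
      = 2 * ∑ i ∈ Finset.univ.erase ν.best,
          (max (ν.mean ν.best) c - max (ν.mean i) c) / ν.gap i ^ 2 := by
    rw [add_zero, Finset.mul_sum]
    exact Finset.sum_congr rfl fun i _ => by ring
  rw [hval] at hlim
  -- The comparison is with a convergent majorant; in `EReal` the limsup is monotone without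
  -- boundedness conditions.
  rw [← ((continuous_coe_real_ereal.tendsto _).comp hlim).limsup_eq]
  refine limsup_le_limsup ?_
  filter_upwards [eventually_ge_atTop 2] with T hT
  have hlog := log_natCast_pos_of_two_le hT
  refine EReal.coe_le_coe_iff.2 ?_
  -- The best arm has weight zero in the first sum, so its pull count, which is not logarithmic,
  -- drops out.
  rw [fixedRewardRegret_eq, add_div, ← Finset.add_sum_erase _ _ (Finset.mem_univ ν.best), sub_self,
    zero_mul, zero_add, Finset.sum_div]
  refine add_le_add (le_of_eq (Finset.sum_congr rfl fun i _ => mul_div_assoc _ _ _)) ?_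
  gcongr
  exact Finset.sum_le_sum fun i _ => abs_mul_expectedWrong_le ν (ALG T) c T i

end Wrapper

end AbstainingBandit

end

theorem theorem3 :
    (∀ (K : ℕ) (ALG : AbstainingBandit.Algorithm K),
      AbstainingBandit.IsAsymptoticallyOptimal ALG →
      AbstainingBandit.IsMinimaxOptimal ALG →
      ∀ (c : ℝ) (ν : AbstainingBandit.Instance K),
        limsup (fun T : ℕ =>
          ((AbstainingBandit.fixedRewardRegret ν c T
              (AbstainingBandit.withAbstention c (ALG T)) / Real.log T : ℝ) : EReal)) atTop ≤
        ((2 * ∑ i ∈ Finset.univ.erase ν.best,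
            (max (ν.mean ν.best) c - max (ν.mean i) c) / ν.gap i ^ 2 : ℝ) : EReal)) ∧
    (∀ α₁ : ℝ, 0 < α₁ → ∃ α : ℝ, 0 < α ∧
      ∀ (K : ℕ) (ALG : AbstainingBandit.Algorithm K),
        AbstainingBandit.IsAsymptoticallyOptimal ALG →
        AbstainingBandit.IsMinimaxOptimalWith α₁ ALG →
        ∀ (c : ℝ) (ν : AbstainingBandit.Instance K) (T : ℕ),
          AbstainingBandit.fixedRewardRegret ν c T
              (AbstainingBandit.withAbstention c (ALG T)) ≤
            α * (√((K : ℝ) * T) + ∑ i, (max (ν.mean ν.best) c - ν.mean i))) := by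
  refine ⟨fun K ALG h _ c ν => h.limsup_fixedRewardRegret_le ν c, fun α₁ hα₁ =>
    ⟨α₁ + 3, by positivity, fun K ALG _ h c ν T => ?_⟩⟩
  exact AbstainingBandit.fixedRewardRegret_le_of_canonicalRegret_le ν (ALG T) hα₁ c T (h ν T)
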